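/- **Setting.** Fix integers $\ell\ge 1$, $n_c\ge 1$ and real numbers $\kappa\ge 0$, $\rho>0$, $\epsilon$ (the case of interest being $0\le\epsilon<1$). Let $\mu_H=\sqrt{\kappa/(1+\kappa)}$ and $\sigma_H^2=(1+\kappa)^{-1}$. The Rician memoryless block-fading channel maps $(x_1,\dots,x_\ell)\in(\mathbb C^{n_c})^\ell$ to $Y_k=H_kx_k+W_k$, $k=1,\dots,\ell$, where all $H_k\sim\mathcal{CN}(\mu_H,\sigma_H^2)$ and $W_k\sim\mathcal{CN}(0,I_{n_c})$ are mutually independent. An $(\ell,n_c,M,\epsilon,\rho)$-code ($M\ge1$) consists of codewords $c_j=(c_{j,1},\dots,c_{j,\ell})\in(\mathbb C^{n_c})^\ell$, $j=1,\dots,M$, with $\|c_{j,k}\|^2=n_c\rho$ for all $j,k$, and a measurable decoder $g:(\mathbb C^{n_c})^\ell\to\{1,\dots,M\}$ with average error probability $$\frac1M\sum_{j=1}^M\Pr\{g(Y^\ell)\ne j\mid x^\ell=c_j\}\le\epsilon .$$ The maximum coding rate, in bits per channel use, is $$R^*=\sup\Big\{\frac{\log_2M}{\ell n_c}:\text{ there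 is an }(\ell,n_c,M,\epsilon,\rho)\text{-code}\Big\}\in[-\infty,+\infty].$$ Let $\log$ be the natural logarithm, $\Gamma$ the Gamma function, and $I_\nu$ the modified Bessel function of the first kind. Put $$\widetilde W_k=\big(\mu_H\sqrt{n_c\rho}+\sqrt{\sigma_H^2n_c\rho+1}\,W_{k,1},\;W_{k,2},\dots,W_{k,n_c}\big)$$ and $$S_k^1=-\log\frac{1+\sigma_H^2n_c\rho}{\sigma_H^2}-\log\Gamma(n_c)-\big(\|W_k\|^2-\|\widetilde W_k\|^2\big)+\frac{\mu_H^2}{\sigma_H^2}-\log\int_0^\infty\frac{e^{-(\rho n_c+\sigma_H^{-2})z}}{\big(\|\widetilde W_k\|\sqrt{\rho n_cz}\big)^{n_c-1}}\,I_{n_c-1}\!\big(2\|\widetilde W_k\|\sqrt{\rho n_cz}\big)\,I_0\!\big(2\sigma_H^{-2}\mu_H\sqrt z\big)\,dz .$$ **Theorem (min-max converse bound).** $$R^*\;\le\;\inf_{\lambda\ge0}\;\frac{1}{\ell n_c\log 2}\left(\lambda-\log\Big[\Pr\Big\{\sum_{k=1}^\ell S_k^1\le\lambda\Big\}-\epsilon\Big]^+\right),$$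 where $[a]^+=\max\{0,a\}$ and $\log 0=-\infty$ (so the bound is $+\infty$ for those $\lambda$ for which the bracket vanishes). -/

import Mathlib

open MeasureTheory ProbabilityTheory
open scoped Nat

noncomputable section

namespace RicianBlockFading

/-- The Euclidean (`l^2`) norm of a complex vector. -/
def l2norm {n : ℕ} (x : Fin n → ℂ) : ℝ := ‖(WithLp.toLp 2 x : EuclideanSpace ℂ (Fin n))‖

/-- The circularly-symmetric complex Gaussian law with mean `m` and variance `v`: real and imaginary
parts are independent real Gaussians of variance `v / 2`. -/
def cgauss (m : ℂ) (v : ℝ) : Measure ℂ :=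
  ((gaussianReal m.re (v / 2).toNNReal).prod (gaussianReal m.im (v / 2).toNNReal)).map
    (fun p : ℝ × ℝ => (⟨p.1, p.2⟩ : ℂ))

/-- The mean of the fading coefficient, for Rician factor `κ`. -/
def muH (κ : ℝ) : ℝ := √(κ / (1 + κ))

/-- The variance of the fading coefficient, for Rician factor `κ`. -/
def sigmaHsq (κ : ℝ) : ℝ := (1 + κ)⁻¹

/-- Joint law of the independent fading coefficients `H_1, …, H_ℓ`. -/
def fadingLaw (κ : ℝ) (ℓ : ℕ) : Measure (Fin ℓ → ℂ) :=
  Measure.pi fun _ => cgauss (muH κ : ℂ) (sigmaHsq κ)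

/-- Joint law of the independent noise vectors `W_1, …, W_ℓ`, each with i.i.d. standard complex
Gaussian entries. -/
def noiseLaw (ℓ nc : ℕ) : Measure (Fin ℓ → Fin nc → ℂ) :=
  Measure.pi fun _ => Measure.pi fun _ => cgauss 0 1

/-- Law of the channel output `Y_k = H_k x_k + W_k`, `k = 1, …, ℓ`, for the input `x`. -/
def outputLaw (κ : ℝ) {ℓ nc : ℕ} (x : Fin ℓ → Fin nc → ℂ) : Measure (Fin ℓ → Fin nc → ℂ) :=
  ((fadingLaw κ ℓ).prod (noiseLaw ℓ nc)).map
    (fun p : (Fin ℓ → ℂ) × (Fin ℓ → Fin nc → ℂ) => fun k i => p.1 k * x k i + p.2 k i)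

/-- An `(ℓ, nc, M, ε, ρ)`-code for the block-fading channel with Rician factor `κ`. -/
structure Code (κ : ℝ) (ℓ nc M : ℕ) (ε ρ : ℝ) where
  /-- the encoder; `encoder j k` is the `k`-th subcodeword of the `j`-th codeword -/
  encoder : Fin M → Fin ℓ → Fin nc → ℂ
  /-- the decoder -/
  decoder : (Fin ℓ → Fin nc → ℂ) → Fin M
  measurable_decoder : Measurable decoder
  power : ∀ j k, l2norm (encoder j k) ^ 2 = nc * ρ
  error : (1 / (M : ℝ)) * ∑ j : Fin M, (outputLaw κ (encoder j)).real {y | decoder y ≠ j} ≤ ε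

/-- The maximum coding rate, in bits per channel use. The supremum is taken in the extended
reals, so that it is never a junk value. -/
def maxRate (κ : ℝ) (ℓ nc : ℕ) (ε ρ : ℝ) : EReal :=
  sSup {r : EReal | ∃ M : ℕ, 0 < M ∧ Nonempty (Code κ ℓ nc M ε ρ) ∧
    r = ((Real.logb 2 (M : ℝ) / ((ℓ : ℝ) * (nc : ℝ)) : ℝ) : EReal)}

/-- Modified Bessel function of the first kind, of integer order `ν`, by its power series
(which converges for every `z`). -/
def besselI (ν : ℕ) (z : ℝ) : ℝ :=
  ∑' m : ℕ, (z / 2) ^ (2 * m + ν) / ((m ! : ℝ) * ((m + ν)! : ℝ))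

/-- The vector obtained from a noise vector `w` by replacing its first entry `w_1` with
`μ_H √(nc ρ) + √(σ_H² nc ρ + 1) w_1`. -/
def wTilde (κ ρ : ℝ) {nc : ℕ} (w : Fin nc → ℂ) : Fin nc → ℂ := fun i =>
  if (i : ℕ) = 0 then
    ((muH κ * √(nc * ρ) : ℝ) : ℂ) + ((√(sigmaHsq κ * nc * ρ + 1) : ℝ) : ℂ) * w i
  else w i

/-- The random variable `S_k^s`, as a function of the noise vector `w = W_k` of block `k`. -/
def S (κ ρ s : ℝ) {nc : ℕ} (w : Fin nc → ℂ) : ℝ :=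
  ((nc : ℝ) - 2) * Real.log s
    - Real.log ((1 + sigmaHsq κ * nc * ρ) / sigmaHsq κ)
    - Real.log (Real.Gamma nc)
    - s * (l2norm w ^ 2 - l2norm (wTilde κ ρ w) ^ 2)
    + s * |muH κ| ^ 2 / sigmaHsq κ
    - Real.log (∫ z in Set.Ioi (0 : ℝ),
        Real.exp (-s * (ρ * nc + (sigmaHsq κ)⁻¹) * z)
            / (l2norm (wTilde κ ρ w) * √(ρ * nc * z)) ^ (nc - 1)
          * besselI (nc - 1) (2 * s * l2norm (wTilde κ ρ w) * √(ρ * nc * z))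
          * besselI 0 (2 * s * (sigmaHsq κ)⁻¹ * √(z * |muH κ| ^ 2)))

end RicianBlockFading

end

noncomputable section

namespace RicianBlockFading

open scoped ENNReal

/-! This is a change-of-measure (meta-converse) argument against one output law that is the same for
all codewords. By unitary invariance of the noise, the output law of any admissible block is a
rotation of the law of `wTilde` (`exists_blockLaw_eq_map`). Take on each block the probability law Q
with density `outputPDF`. It depends on y only through its norm, so rotations do not see it, and its
density ratio to the law of `wTilde`, evaluated at `wTilde w`, is exp(-S w) almost surely
(`exists_outputMeasure`). Hence the information density of every codeword against the product of the
Q's is distributed as ∑ S_k. On the event ∑ S_k ≤ t the output law is at most e^t times this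
product, so P_x(A) ≤ 1 - P(∑ S_k ≤ t) + e^t Q(A) for every admissible x (`exists_outputLaw_le`).
Applied to the decoding regions, whose Q-masses add up to 1, and summed over codewords, this gives M
(P(∑ S_k ≤ t) - ε) ≤ e^t (`Code.card_mul_le`). Taking logarithms finishes. The analytic core is that
Q has mass 1 (`lintegral_outputPDF`). Heuristically Q is the output law of an isotropic input, with
z standing for |H|²; the proof only integrates the Bessel power series termwise. -/

/-! ### Densities of product measures and of images. -/

theorem lintegral_fin_prod_eq_prod {n : ℕ} {E : Type*} {mE : MeasurableSpace E}
    (μ : Fin n → Measure E) [∀ i, SigmaFinite (μ i)]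
    {f : Fin n → E → ℝ≥0∞} (hf : ∀ i, Measurable (f i)) :
    ∫⁻ x : Fin n → E, ∏ i, f i (x i) ∂(Measure.pi μ) = ∏ i, ∫⁻ x, f i x ∂(μ i) := by
  induction n with
  | zero => simp
  | succ n ih =>
    have hmp : MeasurePreserving (MeasurableEquiv.piFinSuccAbove (fun _ => E) 0) (Measure.pi μ)
        ((μ 0).prod (Measure.pi fun j => μ j.succ)) := measurePreserving_piFinSuccAbove μ 0
    have hm : Measurable fun x : Fin n → E => ∏ i : Fin n, f i.succ (x i) :=
      Finset.measurable_fun_prod _ fun i _ => (hf i.succ).comp (measurable_pi_apply i)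
    rw [Fin.prod_univ_succ, ← ih (fun i => μ i.succ) (fun i => hf i.succ),
      ← lintegral_prod_mul (hf 0).aemeasurable hm.aemeasurable,
      ← hmp.lintegral_comp_emb (MeasurableEquiv.measurableEmbedding _)]
    refine lintegral_congr fun x => ?_
    rw [Fin.prod_univ_succ]
    rfl

theorem pi_withDensity {n : ℕ} {E : Type*} {mE : MeasurableSpace E}
    (μ : Fin n → Measure E) [∀ i, SigmaFinite (μ i)]
    {f : Fin n → E → ℝ≥0∞} (hf : ∀ i, Measurable (f i))
    [∀ i, SigmaFinite ((μ i).withDensity (f i))] :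
    Measure.pi (fun i => (μ i).withDensity (f i)) =
      (Measure.pi μ).withDensity fun x => ∏ i, f i (x i) := by
  refine Measure.pi_eq fun s hs => ?_
  rw [withDensity_apply _ (MeasurableSet.univ_pi hs), ← lintegral_indicator (MeasurableSet.univ_pi hs)]
  have h : (Set.univ.pi s).indicator (fun x : Fin n → E => ∏ i, f i (x i)) =
      fun x => ∏ i, (s i).indicator (f i) (x i) := by
    funext x
    by_cases hx : x ∈ Set.univ.pi s
    · rw [Set.indicator_of_mem hx]
      exact Finset.prod_congr rfl fun i _ => (Set.indicator_of_mem (hx i trivial) _).symm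
    · rw [Set.indicator_of_notMem hx]
      simp only [Set.mem_pi, Set.mem_univ, true_implies, not_forall] at hx
      obtain ⟨i, hi⟩ := hx
      exact (Finset.prod_eq_zero (Finset.mem_univ i) (Set.indicator_of_notMem hi _)).symm
  rw [h, lintegral_fin_prod_eq_prod μ fun i => (hf i).indicator (hs i)]
  refine Finset.prod_congr rfl fun i _ => ?_
  rw [lintegral_indicator (hs i), withDensity_apply _ (hs i)]

theorem map_withDensity_comp {α β : Type*} {mα : MeasurableSpace α} {mβ : MeasurableSpace β}
    (μ : Measure α) {f : α → β} (hf : Measurable f) {g : β → ℝ≥0∞} (hg : Measurable g) :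
    (μ.withDensity fun x => g (f x)).map f = (μ.map f).withDensity g := by
  ext s hs
  rw [Measure.map_apply hf hs, withDensity_apply _ (hf hs), withDensity_apply _ hs,
    setLIntegral_map hs hg hf]

/-! ### Complex Gaussian laws: density, characteristic function, affine images and sums. -/

instance (m : ℂ) (v : ℝ) : IsProbabilityMeasure (cgauss m v) :=
  Measure.isProbabilityMeasure_map (by
    exact Complex.measurableEquivRealProd.symm.measurable.aemeasurable)

/-- The density of `cgauss m v`. -/
def cgaussPDF (m : ℂ) (v : ℝ) (z : ℂ) : ℝ := (Real.pi * v)⁻¹ * Real.exp (-(‖z - m‖ ^ 2 / v))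

theorem measurable_cgaussPDF (m : ℂ) (v : ℝ) : Measurable (cgaussPDF m v) := by
  unfold cgaussPDF; fun_prop

theorem cgaussPDF_pos (m : ℂ) {v : ℝ} (hv : 0 < v) (z : ℂ) : 0 < cgaussPDF m v z := by
  unfold cgaussPDF; positivity

theorem cgauss_eq_withDensity (m : ℂ) {v : ℝ} (hv : 0 < v) :
    cgauss m v = volume.withDensity fun z => ENNReal.ofReal (cgaussPDF m v z) := by
  have hv' : (v / 2).toNNReal ≠ 0 := by simpa using hv
  have h1 : (gaussianReal m.re (v / 2).toNNReal).prod (gaussianReal m.im (v / 2).toNNReal) =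
      (volume : Measure (ℝ × ℝ)).withDensity
        fun p => ENNReal.ofReal (cgaussPDF m v (Complex.measurableEquivRealProd.symm p)) := by
    rw [gaussianReal_of_var_ne_zero _ hv', gaussianReal_of_var_ne_zero _ hv',
      prod_withDensity (measurable_gaussianPDF _ _) (measurable_gaussianPDF _ _)]
    congr 1
    funext p
    rw [gaussianPDF, gaussianPDF, ← ENNReal.ofReal_mul (gaussianPDFReal_nonneg _ _ _)]
    congr 1
    have hc : ((v / 2).toNNReal : ℝ) = v / 2 := Real.coe_toNNReal _ (by positivity)
    rw [gaussianPDFReal, gaussianPDFReal, hc, cgaussPDF, mul_mul_mul_comm, ← mul_inv,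
      Real.mul_self_sqrt (by positivity), ← Real.exp_add, Complex.sq_norm, Complex.normSq_apply]
    simp only [Complex.measurableEquivRealProd_symm_apply, Complex.sub_re, Complex.sub_im]
    congr 2
    · ring
    · field_simp
      ring
  rw [cgauss, h1]
  have h2 : (fun p : ℝ × ℝ => (⟨p.1, p.2⟩ : ℂ)) = Complex.measurableEquivRealProd.symm := by
    funext p; rfl
  rw [h2, map_withDensity_comp _ Complex.measurableEquivRealProd.symm.measurable
    (measurable_cgaussPDF m v).ennreal_ofReal,
    (Complex.volume_preserving_equiv_real_prod.symm _).map_eq]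

/-- Real and imaginary parts are independent, so the characteristic function factors. It identifies
the laws of affine images and of H c + W below without convolving densities. -/
theorem charFun_cgauss (m : ℂ) {v : ℝ} (hv : 0 ≤ v) (t : ℂ) :
    charFun (cgauss m v) t =
      Complex.exp (((t.re * m.re + t.im * m.im : ℝ) : ℂ) * Complex.I - v * ‖t‖ ^ 2 / 4) := by
  have h2 : (fun p : ℝ × ℝ => (⟨p.1, p.2⟩ : ℂ)) = Complex.measurableEquivRealProd.symm := by
    funext p; rfl
  have h : charFun (cgauss m v) t = charFun (gaussianReal m.re (v / 2).toNNReal) t.re *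
      charFun (gaussianReal m.im (v / 2).toNNReal) t.im := by
    rw [charFun, cgauss, h2, integral_map_equiv, charFun, charFun, ← integral_prod_mul]
    refine integral_congr_ae (ae_of_all _ fun p => ?_)
    simp only [Complex.measurableEquivRealProd_symm_apply, Complex.inner, ← Complex.exp_add]
    congr 1
    simp
    ring
  have hc : ((v / 2).toNNReal : ℝ) = v / 2 := Real.coe_toNNReal _ (by positivity)
  rw [h, charFun_gaussianReal, charFun_gaussianReal, hc, ← Complex.exp_add]
  congr 1
  have : (‖t‖ : ℂ) ^ 2 = t.re ^ 2 + t.im ^ 2 := by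
    rw [← Complex.ofReal_pow, Complex.sq_norm, Complex.normSq_apply]
    push_cast; ring
  rw [this]
  push_cast
  ring

theorem cgauss_map_affine (a b : ℝ) :
    (cgauss 0 1).map (fun z => (a : ℂ) + (b : ℂ) * z) = cgauss (a : ℂ) (b ^ 2) := by
  have : IsProbabilityMeasure ((cgauss 0 1).map (fun z => (a : ℂ) + (b : ℂ) * z)) :=
    Measure.isProbabilityMeasure_map (by fun_prop)
  refine Measure.ext_of_charFun ?_
  funext t
  have h : (fun z => (a : ℂ) + (b : ℂ) * z) = (fun z => z + (a : ℂ)) ∘ fun z => b • z := by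
    funext z; simp [add_comm]
  rw [h, ← Measure.map_map (by fun_prop) (by fun_prop), charFun_map_add_const, charFun_map_smul,
    charFun_cgauss _ zero_le_one, charFun_cgauss _ (sq_nonneg b), ← Complex.exp_add]
  congr 1
  have hb : ((|b| : ℝ) : ℂ) ^ 2 = (b : ℂ) ^ 2 := by
    rw [← Complex.ofReal_pow, sq_abs, Complex.ofReal_pow]
  simp [Complex.inner, mul_pow, hb]
  ring

theorem cgauss_prod_map (m v c : ℝ) (hv : 0 ≤ v) :
    ((cgauss m v).prod (cgauss 0 1)).map (fun p : ℂ × ℂ => p.1 * (c : ℂ) + p.2) =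
      cgauss ((m * c : ℝ) : ℂ) (c ^ 2 * v + 1) := by
  have h1 : IsProbabilityMeasure ((cgauss m v).map (fun z => c • z)) :=
    Measure.isProbabilityMeasure_map (by fun_prop)
  have h : ((cgauss m v).prod (cgauss 0 1)).map (fun p : ℂ × ℂ => p.1 * (c : ℂ) + p.2) =
      ((cgauss m v).map (fun z => c • z)) ∗ (cgauss 0 1) := by
    have h3 : (cgauss 0 1).map id = cgauss 0 1 := Measure.map_id
    conv_rhs => rw [Measure.conv, ← h3]
    rw [Measure.map_prod_map _ _ (by fun_prop) (by fun_prop),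
      Measure.map_map (by fun_prop) (by fun_prop)]
    congr 1
    funext p
    simp [mul_comm]
  rw [h]
  refine Measure.ext_of_charFun ?_
  funext t
  rw [charFun_conv, charFun_map_smul, charFun_cgauss _ zero_le_one, charFun_cgauss _ hv,
    charFun_cgauss _ (by positivity), ← Complex.exp_add]
  congr 1
  simp [mul_pow, ← Complex.ofReal_pow]
  ring

/-! ### The Euclidean norm and unitary operators on complex tuples. -/

theorem l2norm_sq {n : ℕ} (x : Fin n → ℂ) : l2norm x ^ 2 = ∑ i, ‖x i‖ ^ 2 :=
  EuclideanSpace.norm_sq_eq _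

theorem l2norm_nonneg {n : ℕ} (x : Fin n → ℂ) : 0 ≤ l2norm x := norm_nonneg _

theorem l2norm_eq_zero {n : ℕ} {x : Fin n → ℂ} : l2norm x = 0 ↔ x = 0 := by
  simp [l2norm]

theorem continuous_l2norm {n : ℕ} : Continuous (l2norm : (Fin n → ℂ) → ℝ) :=
  continuous_norm.comp (PiLp.continuous_toLp 2 _)

/-- The action of a unitary operator on complex tuples. -/
def unitaryMap {n : ℕ} (L : EuclideanSpace ℂ (Fin n) ≃ₗᵢ[ℂ] EuclideanSpace ℂ (Fin n))
    (y : Fin n → ℂ) : Fin n → ℂ := WithLp.ofLp (L (WithLp.toLp 2 y))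

section unitaryMap

variable {n : ℕ} (L : EuclideanSpace ℂ (Fin n) ≃ₗᵢ[ℂ] EuclideanSpace ℂ (Fin n))

theorem continuous_unitaryMap : Continuous (unitaryMap L) :=
  (PiLp.continuous_ofLp 2 _).comp (L.continuous.comp (PiLp.continuous_toLp 2 _))

theorem l2norm_unitaryMap (y : Fin n → ℂ) : l2norm (unitaryMap L y) = l2norm y := by
  simp [l2norm, unitaryMap]

theorem unitaryMap_symm_apply (y : Fin n → ℂ) : unitaryMap L.symm (unitaryMap L y) = y := by
  simp [unitaryMap]

theorem unitaryMap_smul_add (h : ℂ) (x w : Fin n → ℂ) :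
    unitaryMap L (h • x + w) = h • unitaryMap L x + unitaryMap L w := by
  simp [unitaryMap]

instance : (Measure.map (WithLp.toLp 2) (volume : Measure (Fin n → ℂ))).IsAddHaarMeasure :=
  (PiLp.continuousLinearEquiv 2 ℂ (fun _ : Fin n => ℂ)).symm.isAddHaarMeasure_map _

/-- By uniqueness of Haar measure the image is a scalar multiple of volume; the Euclidean unit ball
is mapped to itself and has finite positive measure, so the scalar is 1. -/
theorem map_unitaryMap_volume : (volume : Measure (Fin n → ℂ)).map (unitaryMap L) = volume := by
  set μ := Measure.map (WithLp.toLp 2) (volume : Measure (Fin n → ℂ)) with hμ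
  have hm : Measurable (WithLp.toLp 2 : (Fin n → ℂ) → _) := (PiLp.continuous_toLp 2 _).measurable
  have hm' : Measurable (WithLp.ofLp : EuclideanSpace ℂ (Fin n) → _) :=
    (PiLp.continuous_ofLp 2 _).measurable
  have hL : (μ.map L).IsAddHaarMeasure := L.toContinuousLinearEquiv.isAddHaarMeasure_map μ
  have h1 : μ.map L = μ := by
    have h := Measure.isAddLeftInvariant_eq_smul (μ.map L) μ
    set c := (μ.map L).addHaarScalarFactor μ
    have hb : (μ.map L) (Metric.ball 0 1) = μ (Metric.ball 0 1) := by
      rw [Measure.map_apply L.continuous.measurable measurableSet_ball]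
      congr 1
      ext x
      simp
    have hc : (c : ℝ≥0∞) = 1 := by
      rw [h, Measure.smul_apply, ENNReal.smul_def, smul_eq_mul] at hb
      have h0 : μ (Metric.ball 0 1) ≠ 0 := (Metric.measure_ball_pos μ 0 one_pos).ne'
      have ht : μ (Metric.ball 0 1) ≠ ∞ := measure_ball_lt_top.ne
      exact (ENNReal.mul_eq_right h0 ht).1 hb
    rw [h, show c = 1 by exact_mod_cast hc, one_smul]
  have h2 : unitaryMap L = WithLp.ofLp ∘ (L ∘ WithLp.toLp 2) := rfl
  rw [h2, ← Measure.map_map hm' (L.continuous.measurable.comp hm),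
    ← Measure.map_map L.continuous.measurable hm, ← hμ, h1, hμ, Measure.map_map hm' hm]
  exact Measure.map_id

theorem map_unitaryMap_withDensity {g : (Fin n → ℂ) → ℝ≥0∞} (hg : Measurable g)
    (h : ∀ y, g (unitaryMap L y) = g y) :
    ((volume : Measure (Fin n → ℂ)).withDensity g).map (unitaryMap L) =
      (volume : Measure (Fin n → ℂ)).withDensity g := by
  have := map_withDensity_comp volume (continuous_unitaryMap L).measurable hg
  simp_rw [h] at this
  rw [this, map_unitaryMap_volume]

end unitaryMap

/-- For nonzero x, extend x/‖x‖ to an orthonormal basis with this vector at index 0; the coordinate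
map of that basis is the required unitary. -/
theorem exists_unitaryMap_eq_single {n : ℕ} (x : Fin (n + 1) → ℂ) :
    ∃ L : EuclideanSpace ℂ (Fin (n + 1)) ≃ₗᵢ[ℂ] EuclideanSpace ℂ (Fin (n + 1)),
      unitaryMap L x = Pi.single 0 (l2norm x : ℂ) := by
  rcases eq_or_ne x 0 with rfl | hx
  · refine ⟨LinearIsometryEquiv.refl ℂ _, ?_⟩
    simp [unitaryMap, l2norm]
  set e : EuclideanSpace ℂ (Fin (n + 1)) := WithLp.toLp 2 x with he
  have hne : ‖e‖ ≠ 0 := by simpa [he] using hx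
  have hne' : (‖e‖ : ℂ) ≠ 0 := by exact_mod_cast hne
  set v : Fin (n + 1) → EuclideanSpace ℂ (Fin (n + 1)) := fun _ => (‖e‖ : ℂ)⁻¹ • e with hv
  have ho : Orthonormal ℂ (({0} : Set (Fin (n + 1))).domRestrict v) := by
    refine ⟨fun i => ?_, fun i j hij => (hij (Subsingleton.elim _ _)).elim⟩
    simp [hv, norm_smul, hne]
  obtain ⟨b, hb⟩ := ho.exists_orthonormalBasis_extension_of_card_eq (by simp)
  refine ⟨b.repr, ?_⟩
  have h0 : e = (‖e‖ : ℂ) • b 0 := by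
    rw [hb 0 rfl, hv, smul_smul, mul_inv_cancel₀ hne', one_smul]
  have h1 : b.repr e = (‖e‖ : ℂ) • EuclideanSpace.single 0 1 := by
    conv_lhs => rw [h0]
    rw [map_smul, b.repr_self]
  rw [unitaryMap, ← he, h1, l2norm, ← he]
  funext i
  rcases eq_or_ne i 0 with rfl | hi
  · simp
  · simp [hi]

/-! ### The noise vector: rotation invariance and radial moments. -/

/-- The law of a vector of `n` independent standard complex Gaussians. -/
def stdNoise (n : ℕ) : Measure (Fin n → ℂ) := Measure.pi fun _ => cgauss 0 1

instance (n : ℕ) : IsProbabilityMeasure (stdNoise n) := by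
  unfold stdNoise; infer_instance

theorem pi_cgauss_eq_withDensity {n : ℕ} (m : Fin n → ℂ) {v : Fin n → ℝ} (hv : ∀ i, 0 < v i) :
    Measure.pi (fun i => cgauss (m i) (v i)) =
      volume.withDensity fun y => ENNReal.ofReal (∏ i, cgaussPDF (m i) (v i) (y i)) := by
  have h : (fun i => cgauss (m i) (v i)) = fun i =>
      (volume : Measure ℂ).withDensity fun z => ENNReal.ofReal (cgaussPDF (m i) (v i) z) :=
    funext fun i => cgauss_eq_withDensity _ (hv i)
  rw [h, pi_withDensity (fun _ => (volume : Measure ℂ))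
    fun i => (measurable_cgaussPDF (m i) (v i)).ennreal_ofReal, volume_pi]
  congr 1
  funext y
  rw [ENNReal.ofReal_prod_of_nonneg fun i _ => (cgaussPDF_pos _ (hv i) _).le]

theorem prod_cgaussPDF_zero_one {n : ℕ} (y : Fin n → ℂ) :
    ∏ i, cgaussPDF 0 1 (y i) = (Real.pi ^ n)⁻¹ * Real.exp (-l2norm y ^ 2) := by
  simp [cgaussPDF, Finset.prod_mul_distrib, l2norm_sq, ← Real.exp_sum]

theorem stdNoise_eq_withDensity (n : ℕ) : stdNoise n = volume.withDensity fun y =>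
    ENNReal.ofReal ((Real.pi ^ n)⁻¹ * Real.exp (-l2norm y ^ 2)) := by
  rw [stdNoise, pi_cgauss_eq_withDensity _ fun _ => one_pos]
  simp_rw [prod_cgaussPDF_zero_one]

theorem map_unitaryMap_stdNoise {n : ℕ}
    (L : EuclideanSpace ℂ (Fin n) ≃ₗᵢ[ℂ] EuclideanSpace ℂ (Fin n)) :
    (stdNoise n).map (unitaryMap L) = stdNoise n := by
  rw [stdNoise_eq_withDensity]
  refine map_unitaryMap_withDensity L ?_ fun y => by rw [l2norm_unitaryMap]
  have := continuous_l2norm (n := n)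
  fun_prop

/-- The Gaussian integral moments `∫ ‖y‖^(2m) exp(-‖y‖²) dy` over `ℂ^(n+1)`. -/
theorem lintegral_l2norm_pow_mul_exp (n m : ℕ) :
    ∫⁻ y : Fin (n + 1) → ℂ, ENNReal.ofReal (l2norm y ^ (2 * m) * Real.exp (-l2norm y ^ 2)) =
      ENNReal.ofReal (Real.pi ^ (n + 1) * ((m + n)! : ℝ) / (n ! : ℝ)) := by
  set μ := Measure.map (WithLp.toLp 2) (volume : Measure (Fin (n + 1) → ℂ)) with hμ
  have hdim : Module.finrank ℝ (EuclideanSpace ℂ (Fin (n + 1))) = 2 * (n + 1) := by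
    rw [← Module.finrank_mul_finrank ℝ ℂ]; simp
  have hm : Measurable (WithLp.toLp 2 : (Fin (n + 1) → ℂ) → _) :=
    (PiLp.continuous_toLp 2 _).measurable
  have hrad (k : ℕ) : ∀ r ∈ Set.Ioi (0 : ℝ),
      r ^ (2 * n + 1) • (r ^ (2 * k) * Real.exp (-r ^ 2)) =
        r ^ ((2 * (n + k) + 1 : ℕ) : ℝ) * Real.exp (-r ^ (2 : ℝ)) := fun r _ => by
    rw [Real.rpow_natCast, show (2 : ℝ) = ((2 : ℕ) : ℝ) by norm_num, Real.rpow_natCast, smul_eq_mul,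
      ← mul_assoc, ← pow_add]
    congr 2
    ring
  have hradint (k : ℕ) : IntegrableOn
      (fun r : ℝ => r ^ (2 * n + 1) • (r ^ (2 * k) * Real.exp (-r ^ 2))) (Set.Ioi 0) := by
    rw [integrableOn_congr_fun (hrad k) measurableSet_Ioi]
    have := integrableOn_rpow_mul_exp_neg_rpow (p := 2) (s := ((2 * (n + k) + 1 : ℕ) : ℝ))
      (by have : (0 : ℝ) ≤ ((2 * (n + k) + 1 : ℕ) : ℝ) := Nat.cast_nonneg _
          linarith) (by norm_num)
    exact this
  have hradval (k : ℕ) :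
      ∫ r in Set.Ioi (0 : ℝ), r ^ (2 * n + 1) • (r ^ (2 * k) * Real.exp (-r ^ 2)) =
        ((n + k)! : ℝ) / 2 := by
    rw [setIntegral_congr_fun measurableSet_Ioi (hrad k),
      integral_rpow_mul_exp_neg_rpow (by norm_num)
        (by have : (0 : ℝ) ≤ ((2 * (n + k) + 1 : ℕ) : ℝ) := Nat.cast_nonneg _
            linarith)]
    have : (((2 * (n + k) + 1 : ℕ) : ℝ) + 1) / 2 = ((n + k : ℕ) : ℝ) + 1 := by
      push_cast; ring
    rw [this, Real.Gamma_nat_eq_factorial]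
    ring
  have hval (k : ℕ) : ∫⁻ y : Fin (n + 1) → ℂ,
      ENNReal.ofReal (l2norm y ^ (2 * k) * Real.exp (-l2norm y ^ 2)) =
        ENNReal.ofReal ((2 * (n + 1) : ℕ) * μ.real (Metric.ball 0 1) * (((n + k)! : ℝ) / 2)) := by
    have h1 : ∫⁻ y : Fin (n + 1) → ℂ,
        ENNReal.ofReal (l2norm y ^ (2 * k) * Real.exp (-l2norm y ^ 2)) =
        ∫⁻ x, ENNReal.ofReal (‖x‖ ^ (2 * k) * Real.exp (-‖x‖ ^ 2)) ∂μ := by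
      rw [hμ, lintegral_map (by fun_prop) hm]
      rfl
    rw [h1, ← ofReal_integral_eq_lintegral_ofReal
      ((integrable_fun_norm_addHaar μ (f := fun r => r ^ (2 * k) * Real.exp (-r ^ 2))).2
        (by rw [hdim]; exact hradint k)) (ae_of_all _ fun x => by positivity),
      integral_fun_norm_addHaar μ (fun r => r ^ (2 * k) * Real.exp (-r ^ 2)), hdim]
    congr 1
    rw [show 2 * (n + 1) - 1 = 2 * n + 1 by omega, hradval k]
    simp [mul_assoc]
  -- Polar coordinates leave the volume of the unit ball as an unknown constant. The zeroth moment
  -- is known from the normalisation of `stdNoise`, and this eliminates the constant.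
  have hnorm : ∫⁻ y : Fin (n + 1) → ℂ,
      ENNReal.ofReal (l2norm y ^ (2 * 0) * Real.exp (-l2norm y ^ 2)) =
        ENNReal.ofReal (Real.pi ^ (n + 1)) := by
    have h1 : stdNoise (n + 1) Set.univ = 1 := measure_univ
    rw [stdNoise_eq_withDensity, withDensity_apply _ MeasurableSet.univ, setLIntegral_univ] at h1
    simp_rw [ENNReal.ofReal_mul (inv_nonneg.2 (pow_nonneg Real.pi_pos.le (n + 1)))] at h1
    rw [lintegral_const_mul' _ _ ENNReal.ofReal_ne_top, ENNReal.ofReal_inv_of_pos (by positivity)]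
      at h1
    have h2 := ENNReal.eq_inv_of_mul_eq_one_left ((mul_comm _ _).trans h1)
    rw [inv_inv] at h2
    simpa using h2
  rw [hval 0, ENNReal.ofReal_eq_ofReal_iff (by positivity) (by positivity)] at hnorm
  rw [hval m]
  congr 1
  have hn : ((n)! : ℝ) ≠ 0 := by positivity
  rw [← hnorm, add_comm m n]
  field_simp
  simp

/-! ### Reduction of one channel block to the law of `wTilde`. -/

/-- The law of one block of the channel output for the input subcodeword `x`. -/
def blockLaw (κ : ℝ) {n : ℕ} (x : Fin n → ℂ) : Measure (Fin n → ℂ) :=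
  ((cgauss (muH κ : ℂ) (sigmaHsq κ)).prod (stdNoise n)).map
    (fun p : ℂ × (Fin n → ℂ) => fun i => p.1 * x i + p.2 i)

theorem outputLaw_eq_pi (κ : ℝ) {ℓ n : ℕ} (x : Fin ℓ → Fin n → ℂ) :
    outputLaw κ x = Measure.pi fun k => blockLaw κ (x k) := by
  unfold blockLaw
  have hmeas (k : Fin ℓ) : Measurable
      (fun p : ℂ × (Fin n → ℂ) => fun i => p.1 * x k i + p.2 i) := by fun_prop
  have (k : Fin ℓ) : IsProbabilityMeasure
      (((cgauss (muH κ : ℂ) (sigmaHsq κ)).prod (stdNoise n)).map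
        (fun p : ℂ × (Fin n → ℂ) => fun i => p.1 * x k i + p.2 i)) :=
    Measure.isProbabilityMeasure_map (hmeas k).aemeasurable
  rw [← Measure.pi_map_pi fun k => (hmeas k).aemeasurable]
  have h := measurePreserving_arrowProdEquivProdArrow ℂ (Fin n → ℂ) (Fin ℓ)
    (fun _ => cgauss (muH κ : ℂ) (sigmaHsq κ)) (fun _ => stdNoise n)
  rw [outputLaw, fadingLaw, noiseLaw]
  change Measure.map _ ((Measure.pi fun _ => cgauss (muH κ : ℂ) (sigmaHsq κ)).prod
    (Measure.pi fun _ => stdNoise n)) = _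
  rw [← h.map_eq, Measure.map_map (by fun_prop) (MeasurableEquiv.measurable _)]
  rfl

/-- The law of `W̃`. -/
def refLaw (κ ρ : ℝ) (n : ℕ) : Measure (Fin n → ℂ) :=
  Measure.pi fun i : Fin n =>
    if (i : ℕ) = 0 then cgauss ((muH κ * √(n * ρ) : ℝ) : ℂ) (sigmaHsq κ * n * ρ + 1)
    else cgauss 0 1

instance (κ ρ : ℝ) (n : ℕ) (i : Fin n) : IsProbabilityMeasure
    (if (i : ℕ) = 0 then cgauss ((muH κ * √(n * ρ) : ℝ) : ℂ) (sigmaHsq κ * n * ρ + 1)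
    else cgauss 0 1) := by
  split_ifs <;> infer_instance

theorem sigmaHsq_pos {κ : ℝ} (hκ : 0 ≤ κ) : 0 < sigmaHsq κ := by
  unfold sigmaHsq; positivity

theorem continuous_wTilde (κ ρ : ℝ) (n : ℕ) : Continuous (wTilde κ ρ (nc := n)) := by
  refine continuous_pi fun i => ?_
  unfold wTilde
  split_ifs <;> fun_prop

theorem map_wTilde {κ ρ : ℝ} (hκ : 0 ≤ κ) (hρ : 0 < ρ) (n : ℕ) :
    (stdNoise n).map (wTilde κ ρ) = refLaw κ ρ n := by
  have hs := sigmaHsq_pos hκ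
  set f : Fin n → ℂ → ℂ := fun i z => if (i : ℕ) = 0 then
    ((muH κ * √(n * ρ) : ℝ) : ℂ) + ((√(sigmaHsq κ * n * ρ + 1) : ℝ) : ℂ) * z
    else z with hf
  have hfm (i : Fin n) : Measurable (f i) := by
    simp only [hf]; split_ifs <;> fun_prop
  have hfi (i : Fin n) : (cgauss 0 1).map (f i) =
      if (i : ℕ) = 0 then cgauss ((muH κ * √(n * ρ) : ℝ) : ℂ) (sigmaHsq κ * n * ρ + 1)
      else cgauss 0 1 := by
    simp only [hf]
    split_ifs
    · rw [cgauss_map_affine, Real.sq_sqrt (by positivity)]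
    · exact Measure.map_id
  have (i : Fin n) : IsProbabilityMeasure ((cgauss 0 1).map (f i)) :=
    Measure.isProbabilityMeasure_map (hfm i).aemeasurable
  rw [refLaw]
  simp_rw [← hfi]
  rw [← Measure.pi_map_pi fun i => (hfm i).aemeasurable]
  rfl

/-- An input along the first axis puts all the fading into coordinate 0, where H c + W is again
Gaussian; the other coordinates are pure noise. -/
theorem blockLaw_single {κ ρ : ℝ} (hκ : 0 ≤ κ) (hρ : 0 < ρ) (n : ℕ) :
    blockLaw κ (Pi.single 0 ((√((n + 1 : ℕ) * ρ) : ℝ) : ℂ) : Fin (n + 1) → ℂ) =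
      refLaw κ ρ (n + 1) := by
  set c : ℝ := √((n + 1 : ℕ) * ρ) with hc
  set τ : Fin (n + 1) → Measure ℂ := fun i =>
    if (i : ℕ) = 0 then cgauss ((muH κ * √((n + 1 : ℕ) * ρ) : ℝ) : ℂ)
      (sigmaHsq κ * (n + 1 : ℕ) * ρ + 1) else cgauss 0 1 with hτ
  have h1 : MeasurePreserving (MeasurableEquiv.piFinSuccAbove (fun _ => ℂ) 0) (stdNoise (n + 1))
      ((cgauss 0 1).prod (stdNoise n)) := measurePreserving_piFinSuccAbove (fun _ => cgauss 0 1) 0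
  have h2 : MeasurePreserving (MeasurableEquiv.piFinSuccAbove (fun _ => ℂ) 0)
      (refLaw κ ρ (n + 1)) ((cgauss ((muH κ * c : ℝ) : ℂ) (c ^ 2 * sigmaHsq κ + 1)).prod
        (stdNoise n)) := by
    have h := measurePreserving_piFinSuccAbove τ 0
    have e0 : τ 0 = cgauss ((muH κ * c : ℝ) : ℂ) (c ^ 2 * sigmaHsq κ + 1) := by
      simp only [hτ, Fin.val_zero, if_true]
      rw [hc, Real.sq_sqrt (by positivity)]
      congr 1
      ring
    have e1 : (Measure.pi fun j : Fin n => τ (Fin.succAbove 0 j)) = stdNoise n := by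
      simp [hτ, stdNoise]
    rw [e0, e1] at h
    exact h
  have h3 : MeasurePreserving (fun p : ℂ × ℂ => p.1 * (c : ℂ) + p.2)
      ((cgauss (muH κ : ℂ) (sigmaHsq κ)).prod (cgauss 0 1))
      (cgauss ((muH κ * c : ℝ) : ℂ) (c ^ 2 * sigmaHsq κ + 1)) :=
    ⟨by fun_prop, cgauss_prod_map _ _ _ (sigmaHsq_pos hκ).le⟩
  -- Read from the inside out: split off the first noise coordinate, regroup it with H, merge the
  -- pair by `h3`, and reassemble the vector.
  have h4 := (((h2.symm _).comp (h3.prod (MeasurePreserving.id (stdNoise n)))).comp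
    ((measurePreserving_prodAssoc (cgauss (muH κ : ℂ) (sigmaHsq κ)) (cgauss 0 1)
      (stdNoise n)).symm _)).comp
    ((MeasurePreserving.id (cgauss (muH κ : ℂ) (sigmaHsq κ))).prod h1)
  rw [blockLaw, ← h4.map_eq]
  congr 1
  funext p i
  refine Fin.cases ?_ (fun j => ?_) i
  · simp [MeasurableEquiv.piFinSuccAbove, MeasurableEquiv.prodAssoc]
  · simp [MeasurableEquiv.piFinSuccAbove, MeasurableEquiv.prodAssoc, Fin.tail]

theorem exists_blockLaw_eq_map {κ ρ : ℝ} (hκ : 0 ≤ κ) (hρ : 0 < ρ) {n : ℕ}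
    (x : Fin (n + 1) → ℂ) (hx : l2norm x ^ 2 = (n + 1 : ℕ) * ρ) :
    ∃ L : EuclideanSpace ℂ (Fin (n + 1)) ≃ₗᵢ[ℂ] EuclideanSpace ℂ (Fin (n + 1)),
      blockLaw κ x = (refLaw κ ρ (n + 1)).map (unitaryMap L) := by
  obtain ⟨L, hL⟩ := exists_unitaryMap_eq_single x
  refine ⟨L.symm, ?_⟩
  have hx' : l2norm x = √((n + 1 : ℕ) * ρ) := by
    rw [← hx, Real.sqrt_sq (l2norm_nonneg x)]
  rw [hx'] at hL
  have hmeas (x : Fin (n + 1) → ℂ) : Measurable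
      (fun p : ℂ × (Fin (n + 1) → ℂ) => fun i => p.1 * x i + p.2 i) := by fun_prop
  have hLm := (continuous_unitaryMap L).measurable
  have hLm' := (continuous_unitaryMap L.symm).measurable
  rw [← blockLaw_single hκ hρ, ← hL, blockLaw, blockLaw, Measure.map_map hLm' (hmeas _)]
  -- Replacing the noise by its rotation under `L` lets `L.symm` undo both the rotation of the input
  -- and that of the noise.
  conv_rhs => rw [← map_unitaryMap_stdNoise L]
  have hid : (cgauss (muH κ : ℂ) (sigmaHsq κ)).map id = cgauss (muH κ : ℂ) (sigmaHsq κ) :=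
    Measure.map_id
  conv_rhs => rw [← hid]
  rw [Measure.map_prod_map _ _ measurable_id hLm,
    Measure.map_map (hLm'.comp (hmeas _)) (measurable_id.prodMap hLm)]
  congr 1
  funext p
  have e := unitaryMap_symm_apply L (p.1 • x + p.2)
  rw [unitaryMap_smul_add] at e
  exact e.symm

/-! ### Bessel series and their Gaussian and exponential integrals. -/

/-- The series `∑ x^m / (m! (m+ν)!)` in the extended nonnegative reals. -/
def besselSeries (ν : ℕ) (x : ℝ) : ℝ≥0∞ :=
  ∑' m : ℕ, ENNReal.ofReal (x ^ m / ((m ! : ℝ) * ((m + ν)! : ℝ)))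

theorem measurable_besselSeries (ν : ℕ) : Measurable (besselSeries ν) :=
  Measurable.tsum fun m => by fun_prop

theorem summable_besselSeries (ν : ℕ) {x : ℝ} (hx : 0 ≤ x) :
    Summable fun m : ℕ => x ^ m / ((m ! : ℝ) * ((m + ν)! : ℝ)) := by
  refine Summable.of_nonneg_of_le (fun m => by positivity) (fun m => ?_)
    (Real.summable_pow_div_factorial x)
  have h1 : (1 : ℝ) ≤ ((m + ν)! : ℝ) := by exact_mod_cast Nat.factorial_pos _
  have h2 : (0 : ℝ) < (m ! : ℝ) := by positivity
  gcongr
  nlinarith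

theorem besselSeries_eq_ofReal (ν : ℕ) {x : ℝ} (hx : 0 ≤ x) :
    besselSeries ν x = ENNReal.ofReal (∑' m : ℕ, x ^ m / ((m ! : ℝ) * ((m + ν)! : ℝ))) :=
  (ENNReal.ofReal_tsum_of_nonneg (fun m => by positivity) (summable_besselSeries ν hx)).symm

theorem besselSeries_ne_top (ν : ℕ) {x : ℝ} (hx : 0 ≤ x) : besselSeries ν x ≠ ∞ := by
  rw [besselSeries_eq_ofReal ν hx]
  exact ENNReal.ofReal_ne_top

theorem besselSeries_ne_zero (ν : ℕ) (x : ℝ) : besselSeries ν x ≠ 0 := by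
  intro h
  have h0 := ENNReal.tsum_eq_zero.1 h 0
  rw [ENNReal.ofReal_eq_zero] at h0
  have : 0 < x ^ 0 / (((0 : ℕ)! : ℝ) * ((0 + ν)! : ℝ)) := by
    rw [pow_zero]; positivity
  linarith

/-- The extracted power of a is what the denominator in `S` cancels, leaving a nonnegative series
that can be integrated termwise. -/
theorem besselI_two_mul (ν : ℕ) (a : ℝ) :
    besselI ν (2 * a) = a ^ ν * (besselSeries ν (a ^ 2)).toReal := by
  rw [besselSeries_eq_ofReal ν (sq_nonneg a),
    ENNReal.toReal_ofReal (tsum_nonneg fun m => by positivity), ← tsum_mul_left, besselI]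
  refine tsum_congr fun m => ?_
  rw [mul_div_cancel_left₀ a two_ne_zero, pow_add, pow_mul]
  ring

/-- The 2m-th radial moment supplies exactly the factor (m+n)! in the denominator of the m-th term,
so the exponential series remains. -/
theorem lintegral_exp_mul_besselSeries_l2norm (n : ℕ) {x : ℝ} (hx : 0 ≤ x) :
    ∫⁻ y : Fin (n + 1) → ℂ,
        ENNReal.ofReal (Real.exp (-l2norm y ^ 2)) * besselSeries n (l2norm y ^ 2 * x) =
      ENNReal.ofReal (Real.pi ^ (n + 1) / (n ! : ℝ) * Real.exp x) := by
  have hc := continuous_l2norm (n := n + 1)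
  have hterm (y : Fin (n + 1) → ℂ) : ENNReal.ofReal (Real.exp (-l2norm y ^ 2)) *
      besselSeries n (l2norm y ^ 2 * x) = ∑' m : ℕ,
        ENNReal.ofReal (x ^ m / ((m ! : ℝ) * ((m + n)! : ℝ))) *
          ENNReal.ofReal (l2norm y ^ (2 * m) * Real.exp (-l2norm y ^ 2)) := by
    rw [besselSeries, ← ENNReal.tsum_mul_left]
    refine tsum_congr fun m => ?_
    rw [← ENNReal.ofReal_mul (Real.exp_pos _).le, ← ENNReal.ofReal_mul (by positivity)]
    congr 1
    rw [mul_pow, ← pow_mul]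
    ring
  simp_rw [hterm]
  rw [lintegral_tsum fun m => by fun_prop]
  simp_rw [lintegral_const_mul' _ _ ENNReal.ofReal_ne_top, lintegral_l2norm_pow_mul_exp]
  have hexp : Real.pi ^ (n + 1) / (n ! : ℝ) * Real.exp x =
      ∑' m : ℕ, Real.pi ^ (n + 1) / (n ! : ℝ) * (x ^ m / (m ! : ℝ)) := by
    rw [tsum_mul_left, Real.exp_eq_exp_ℝ, NormedSpace.exp_eq_tsum_div]
  rw [hexp, ENNReal.ofReal_tsum_of_nonneg (fun m => by positivity)
    ((Real.summable_pow_div_factorial x).mul_left _)]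
  refine tsum_congr fun m => ?_
  rw [← ENNReal.ofReal_mul (by positivity)]
  congr 1
  field_simp

/-- The Gamma integral m!/s^(m+1) cancels one of the two factorials, which again leaves an
exponential series. -/
theorem lintegral_exp_mul_besselSeries_zero {s c : ℝ} (hs : 0 < s) (hc : 0 ≤ c) :
    ∫⁻ z in Set.Ioi (0 : ℝ), ENNReal.ofReal (Real.exp (-(s * z))) * besselSeries 0 (c * z) =
      ENNReal.ofReal (s⁻¹ * Real.exp (c / s)) := by
  have hterm : ∀ z ∈ Set.Ioi (0 : ℝ), ENNReal.ofReal (Real.exp (-(s * z))) *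
      besselSeries 0 (c * z) = ∑' m : ℕ,
        ENNReal.ofReal (c ^ m / ((m ! : ℝ) * (m ! : ℝ))) *
          ENNReal.ofReal (z ^ m * Real.exp (-(s * z))) := by
    intro z hz
    rw [besselSeries, ← ENNReal.tsum_mul_left]
    refine tsum_congr fun m => ?_
    rw [← ENNReal.ofReal_mul (Real.exp_pos _).le, ← ENNReal.ofReal_mul (by positivity), mul_pow]
    congr 1
    rw [add_zero]
    ring
  have hmom (m : ℕ) : ∫⁻ z in Set.Ioi (0 : ℝ), ENNReal.ofReal (z ^ m * Real.exp (-(s * z))) =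
      ENNReal.ofReal ((m ! : ℝ) / s ^ (m + 1)) := by
    have hval := Real.integral_rpow_mul_exp_neg_mul_Ioi (a := (m : ℝ) + 1) (by positivity) hs
    simp only [add_sub_cancel_right, Real.rpow_natCast, Real.Gamma_nat_eq_factorial] at hval
    have hpos : 0 < ∫ z in Set.Ioi (0 : ℝ), z ^ m * Real.exp (-(s * z)) := by
      rw [hval]; positivity
    rw [← ofReal_integral_eq_lintegral_ofReal (Integrable.of_integral_ne_zero hpos.ne')
      ((ae_restrict_iff' measurableSet_Ioi).2 (ae_of_all _ fun z hz => ?_)), hval]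
    · congr 1
      rw [show (m : ℝ) + 1 = ((m + 1 : ℕ) : ℝ) by push_cast; ring, Real.rpow_natCast, div_pow,
        one_pow]
      ring
    · have : (0 : ℝ) < z := hz
      simp only [Pi.zero_apply]
      positivity
  rw [setLIntegral_congr_fun measurableSet_Ioi hterm, lintegral_tsum fun m => by fun_prop]
  simp_rw [lintegral_const_mul' _ _ ENNReal.ofReal_ne_top, hmom]
  have hexp : s⁻¹ * Real.exp (c / s) = ∑' m : ℕ, s⁻¹ * ((c / s) ^ m / (m ! : ℝ)) := by
    rw [tsum_mul_left, Real.exp_eq_exp_ℝ, NormedSpace.exp_eq_tsum_div]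
  rw [hexp, ENNReal.ofReal_tsum_of_nonneg (fun m => by positivity)
    ((Real.summable_pow_div_factorial _).mul_left _)]
  refine tsum_congr fun m => ?_
  rw [← ENNReal.ofReal_mul (by positivity)]
  congr 1
  rw [div_pow, pow_succ]
  field_simp

/-! ### The rotation-invariant output density. -/

/-- The integrand of `radialIntegral`. -/
def radialKernel (κ ρ : ℝ) (n : ℕ) (r z : ℝ) : ℝ≥0∞ :=
  ENNReal.ofReal (Real.exp (-((ρ * (n + 1 : ℕ) + (sigmaHsq κ)⁻¹) * z))) *
    besselSeries n (r ^ 2 * (ρ * (n + 1 : ℕ) * z)) *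
      besselSeries 0 (((sigmaHsq κ)⁻¹ * muH κ) ^ 2 * z)

/-- The integral appearing in the output density, as a function of the norm of the output. -/
def radialIntegral (κ ρ : ℝ) (n : ℕ) (r : ℝ) : ℝ≥0∞ :=
  ∫⁻ z in Set.Ioi (0 : ℝ), radialKernel κ ρ n r z

/-- The density of the output distribution used in the converse bound. -/
def outputPDF (κ ρ : ℝ) (n : ℕ) (y : Fin (n + 1) → ℂ) : ℝ≥0∞ :=
  ENNReal.ofReal ((Real.pi ^ (n + 1))⁻¹ * (n ! : ℝ) * (sigmaHsq κ)⁻¹ *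
    Real.exp (-(muH κ ^ 2 / sigmaHsq κ))) *
    (ENNReal.ofReal (Real.exp (-l2norm y ^ 2)) * radialIntegral κ ρ n (l2norm y))

theorem measurable_radialKernel (κ ρ : ℝ) (n : ℕ) :
    Measurable fun p : ℝ × ℝ => radialKernel κ ρ n p.1 p.2 := by
  unfold radialKernel
  refine Measurable.mul (Measurable.mul (by fun_prop) ?_) ?_
  · exact (measurable_besselSeries n).comp (by fun_prop)
  · exact (measurable_besselSeries 0).comp (by fun_prop)

theorem measurable_radialIntegral (κ ρ : ℝ) (n : ℕ) : Measurable (radialIntegral κ ρ n) :=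
  Measurable.lintegral_prod_right (measurable_radialKernel κ ρ n)

theorem measurable_outputPDF (κ ρ : ℝ) (n : ℕ) : Measurable (outputPDF κ ρ n) := by
  have hc := continuous_l2norm (n := n + 1)
  unfold outputPDF
  refine Measurable.const_mul (Measurable.mul (by fun_prop) ?_) _
  exact (measurable_radialIntegral κ ρ n).comp hc.measurable

/-- By Tonelli, integrate over y first: this yields exp(ρ(n+1)z), cancelling that part of the
kernel. The remaining z-integral is σ² exp(μ²/σ²), which the normalising constant absorbs. -/
theorem lintegral_outputPDF {κ ρ : ℝ} (hκ : 0 ≤ κ) (hρ : 0 < ρ) (n : ℕ) :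
    ∫⁻ y, outputPDF κ ρ n y = 1 := by
  have hs := sigmaHsq_pos hκ
  have hc := continuous_l2norm (n := n + 1)
  have hk : Measurable fun p : (Fin (n + 1) → ℂ) × ℝ =>
      ENNReal.ofReal (Real.exp (-l2norm p.1 ^ 2)) * radialKernel κ ρ n (l2norm p.1) p.2 := by
    have h1 : Measurable fun p : (Fin (n + 1) → ℂ) × ℝ => l2norm p.1 :=
      hc.measurable.comp measurable_fst
    have h2 : Measurable fun p : (Fin (n + 1) → ℂ) × ℝ => (l2norm p.1, p.2) :=
      h1.prodMk measurable_snd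
    exact ((h1.pow_const 2).neg.exp.ennreal_ofReal).mul ((measurable_radialKernel κ ρ n).comp h2)
  have hswap : ∫⁻ y : Fin (n + 1) → ℂ,
      ENNReal.ofReal (Real.exp (-l2norm y ^ 2)) * radialIntegral κ ρ n (l2norm y) =
      ∫⁻ z in Set.Ioi (0 : ℝ), ∫⁻ y : Fin (n + 1) → ℂ,
        ENNReal.ofReal (Real.exp (-l2norm y ^ 2)) * radialKernel κ ρ n (l2norm y) z := by
    rw [← lintegral_lintegral_swap hk.aemeasurable]
    refine lintegral_congr fun y => ?_
    rw [radialIntegral, lintegral_const_mul' _ _ ENNReal.ofReal_ne_top]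
  unfold outputPDF
  rw [lintegral_const_mul' _ _ ENNReal.ofReal_ne_top, hswap]
  have hinner : ∀ z ∈ Set.Ioi (0 : ℝ), ∫⁻ y : Fin (n + 1) → ℂ,
      ENNReal.ofReal (Real.exp (-l2norm y ^ 2)) * radialKernel κ ρ n (l2norm y) z =
      ENNReal.ofReal (Real.pi ^ (n + 1) / (n ! : ℝ)) *
        (ENNReal.ofReal (Real.exp (-((sigmaHsq κ)⁻¹ * z))) *
          besselSeries 0 (((sigmaHsq κ)⁻¹ * muH κ) ^ 2 * z)) := by
    intro z hz
    have hz : (0 : ℝ) < z := hz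
    have e : ∀ y : Fin (n + 1) → ℂ,
        ENNReal.ofReal (Real.exp (-l2norm y ^ 2)) * radialKernel κ ρ n (l2norm y) z =
        (ENNReal.ofReal (Real.exp (-((ρ * (n + 1 : ℕ) + (sigmaHsq κ)⁻¹) * z))) *
          besselSeries 0 (((sigmaHsq κ)⁻¹ * muH κ) ^ 2 * z)) *
          (ENNReal.ofReal (Real.exp (-l2norm y ^ 2)) *
            besselSeries n (l2norm y ^ 2 * (ρ * (n + 1 : ℕ) * z))) := by
      intro y
      rw [radialKernel]
      ring
    simp_rw [e]
    rw [lintegral_const_mul' _ _ (ENNReal.mul_ne_top ENNReal.ofReal_ne_top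
      (besselSeries_ne_top 0 (by positivity))),
      lintegral_exp_mul_besselSeries_l2norm n (by positivity), mul_right_comm,
      ← ENNReal.ofReal_mul (Real.exp_pos _).le, ← mul_assoc (ENNReal.ofReal _),
      ← ENNReal.ofReal_mul (by positivity)]
    congr 2
    rw [mul_left_comm, ← Real.exp_add]
    congr 2
    ring
  rw [setLIntegral_congr_fun measurableSet_Ioi hinner,
    lintegral_const_mul' _ _ ENNReal.ofReal_ne_top,
    lintegral_exp_mul_besselSeries_zero (inv_pos.2 hs) (sq_nonneg _),
    ← ENNReal.ofReal_mul (by positivity), ← ENNReal.ofReal_mul (by positivity),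
    ← ENNReal.ofReal_one]
  congr 1
  rw [show ((sigmaHsq κ)⁻¹ * muH κ) ^ 2 / (sigmaHsq κ)⁻¹ = muH κ ^ 2 / sigmaHsq κ by
    field_simp, Real.exp_neg]
  have := Real.exp_pos (muH κ ^ 2 / sigmaHsq κ)
  field_simp

theorem radialIntegral_ne_zero (κ ρ : ℝ) (n : ℕ) (r : ℝ) : radialIntegral κ ρ n r ≠ 0 := by
  have hm : Measurable (radialKernel κ ρ n r) :=
    (measurable_radialKernel κ ρ n).comp measurable_prodMk_left
  rw [radialIntegral, ← pos_iff_ne_zero, lintegral_pos_iff_support hm]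
  have : Function.support (radialKernel κ ρ n r) = Set.univ := by
    refine Set.eq_univ_of_forall fun z => ?_
    exact mul_ne_zero (mul_ne_zero (ENNReal.ofReal_pos.2 (Real.exp_pos _)).ne'
      (besselSeries_ne_zero _ _)) (besselSeries_ne_zero _ _)
  simp [this]

/-- No integrability is needed: the integrand is finite at each z > 0, and a divergent integral
gives 0 on both sides. Positivity of r allows the cancellation of the power in the denominator. -/
theorem integral_bessel_eq_radialIntegral (κ : ℝ) {ρ : ℝ} (hρ : 0 < ρ) (n : ℕ) {r : ℝ}
    (hr : 0 < r) :
    ∫ z in Set.Ioi (0 : ℝ),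
        Real.exp (-1 * (ρ * (n + 1 : ℕ) + (sigmaHsq κ)⁻¹) * z)
            / (r * √(ρ * (n + 1 : ℕ) * z)) ^ (n + 1 - 1)
          * besselI (n + 1 - 1) (2 * 1 * r * √(ρ * (n + 1 : ℕ) * z))
          * besselI 0 (2 * 1 * (sigmaHsq κ)⁻¹ * √(z * |muH κ| ^ 2)) =
      (radialIntegral κ ρ n r).toReal := by
  have hm : Measurable (radialKernel κ ρ n r) :=
    (measurable_radialKernel κ ρ n).comp measurable_prodMk_left
  rw [radialIntegral, ← integral_toReal hm.aemeasurable]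
  · refine setIntegral_congr_fun measurableSet_Ioi fun z hz => ?_
    have hz : (0 : ℝ) < z := hz
    have ha : 0 < r * √(ρ * (n + 1 : ℕ) * z) := by positivity
    have e1 : (2 : ℝ) * 1 * r * √(ρ * (n + 1 : ℕ) * z) = 2 * (r * √(ρ * (n + 1 : ℕ) * z)) := by
      ring
    have e2 : (2 : ℝ) * 1 * (sigmaHsq κ)⁻¹ * √(z * |muH κ| ^ 2) =
        2 * ((sigmaHsq κ)⁻¹ * √(z * |muH κ| ^ 2)) := by ring
    have e3 : (r * √(ρ * (n + 1 : ℕ) * z)) ^ 2 = r ^ 2 * (ρ * (n + 1 : ℕ) * z) := by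
      rw [mul_pow, Real.sq_sqrt (by positivity)]
    have e4 : ((sigmaHsq κ)⁻¹ * √(z * |muH κ| ^ 2)) ^ 2 = ((sigmaHsq κ)⁻¹ * muH κ) ^ 2 * z := by
      rw [mul_pow, Real.sq_sqrt (by positivity), sq_abs]
      ring
    simp only [e1, e2, besselI_two_mul, e3, e4, radialKernel, ENNReal.toReal_mul,
      ENNReal.toReal_ofReal (Real.exp_pos _).le, Nat.add_sub_cancel, pow_zero, one_mul]
    rw [← mul_assoc, div_mul_cancel₀ _ (pow_pos ha n).ne', neg_one_mul, neg_mul]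
  · refine (ae_restrict_iff' measurableSet_Ioi).2 (ae_of_all _ fun z hz => ?_)
    have hz : (0 : ℝ) < z := hz
    exact (ENNReal.mul_ne_top (ENNReal.mul_ne_top ENNReal.ofReal_ne_top
      (besselSeries_ne_top _ (by positivity))) (besselSeries_ne_top _ (by positivity))).lt_top

/-! ### The density ratio and its identification with exp(-S). -/

/-- The density of `refLaw`. -/
def refPDF (κ ρ : ℝ) (n : ℕ) (y : Fin (n + 1) → ℂ) : ℝ :=
  ∏ i : Fin (n + 1), cgaussPDF
    (if (i : ℕ) = 0 then ((muH κ * √((n + 1 : ℕ) * ρ) : ℝ) : ℂ) else 0)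
    (if (i : ℕ) = 0 then sigmaHsq κ * (n + 1 : ℕ) * ρ + 1 else 1) (y i)

theorem measurable_refPDF (κ ρ : ℝ) (n : ℕ) : Measurable (refPDF κ ρ n) :=
  Finset.measurable_fun_prod _ fun i _ => (measurable_cgaussPDF _ _).comp (measurable_pi_apply i)

theorem refPDF_pos {κ ρ : ℝ} (hκ : 0 ≤ κ) (hρ : 0 < ρ) (n : ℕ) (y : Fin (n + 1) → ℂ) :
    0 < refPDF κ ρ n y := by
  have hs := sigmaHsq_pos hκ
  refine Finset.prod_pos fun i _ => cgaussPDF_pos _ ?_ _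
  split_ifs <;> positivity

theorem refLaw_eq_withDensity {κ ρ : ℝ} (hκ : 0 ≤ κ) (hρ : 0 < ρ) (n : ℕ) :
    refLaw κ ρ (n + 1) = volume.withDensity fun y => ENNReal.ofReal (refPDF κ ρ n y) := by
  have hs := sigmaHsq_pos hκ
  unfold refPDF
  rw [← pi_cgauss_eq_withDensity, refLaw]
  · congr 1
    funext i
    split_ifs <;> rfl
  · intro i
    split_ifs <;> positivity

/-- `wTilde` standardises the first coordinate, so the density pulls back to the standard one
divided by the Jacobian of the scaling. -/
theorem refPDF_wTilde {κ ρ : ℝ} (hκ : 0 ≤ κ) (hρ : 0 < ρ) (n : ℕ) (w : Fin (n + 1) → ℂ) :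
    refPDF κ ρ n (wTilde κ ρ w) = (sigmaHsq κ * (n + 1 : ℕ) * ρ + 1)⁻¹ *
      ((Real.pi ^ (n + 1))⁻¹ * Real.exp (-l2norm w ^ 2)) := by
  have hs := sigmaHsq_pos hκ
  have hv : 0 < sigmaHsq κ * (n + 1 : ℕ) * ρ + 1 := by positivity
  rw [← prod_cgaussPDF_zero_one, refPDF, Fin.prod_univ_succ, Fin.prod_univ_succ, ← mul_assoc]
  congr 1
  · simp only [cgaussPDF, wTilde, Fin.val_zero, if_true, add_sub_cancel_left, norm_mul, mul_pow,
      Complex.norm_real, Real.norm_eq_abs, sq_abs, Real.sq_sqrt hv.le, sub_zero]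
    rw [mul_div_cancel_left₀ _ hv.ne', mul_inv]
    simp only [mul_one, div_one]
    ring

theorem ofReal_exp_neg_S {κ ρ : ℝ} (hκ : 0 ≤ κ) (hρ : 0 < ρ) (n : ℕ) {w : Fin (n + 1) → ℂ}
    (hw : wTilde κ ρ w ≠ 0) (hJ : radialIntegral κ ρ n (l2norm (wTilde κ ρ w)) ≠ ∞) :
    outputPDF κ ρ n (wTilde κ ρ w) / ENNReal.ofReal (refPDF κ ρ n (wTilde κ ρ w)) =
      ENNReal.ofReal (Real.exp (-S κ ρ 1 w)) := by
  have hs := sigmaHsq_pos hκ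
  have hr : 0 < l2norm (wTilde κ ρ w) :=
    (l2norm_nonneg _).lt_of_ne fun h => hw (l2norm_eq_zero.1 h.symm)
  have hI := ENNReal.toReal_pos (radialIntegral_ne_zero κ ρ n (l2norm (wTilde κ ρ w))) hJ
  have hv : 0 < 1 + sigmaHsq κ * (n + 1 : ℕ) * ρ := by positivity
  have hG : (0 : ℝ) < (n ! : ℝ) := by positivity
  have hS : Real.exp (-S κ ρ 1 w) = (1 + sigmaHsq κ * (n + 1 : ℕ) * ρ) / sigmaHsq κ * (n ! : ℝ) *
      Real.exp (l2norm w ^ 2 - l2norm (wTilde κ ρ w) ^ 2) *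
      Real.exp (-(muH κ ^ 2 / sigmaHsq κ)) *
      (radialIntegral κ ρ n (l2norm (wTilde κ ρ w))).toReal := by
    rw [S, integral_bessel_eq_radialIntegral κ hρ n hr, Real.log_one, sq_abs,
      show Real.Gamma ((n + 1 : ℕ) : ℝ) = (n ! : ℝ) by
        rw [Nat.cast_succ, Real.Gamma_nat_eq_factorial]]
    conv_rhs => rw [← Real.exp_log (div_pos hv hs), ← Real.exp_log hG, ← Real.exp_log hI]
    rw [← Real.exp_add, ← Real.exp_add, ← Real.exp_add, ← Real.exp_add]
    congr 1
    ring
  rw [hS, outputPDF, refPDF_wTilde hκ hρ]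
  conv_lhs => rw [← ENNReal.ofReal_toReal hJ]
  rw [← ENNReal.ofReal_mul (Real.exp_pos _).le, ← ENNReal.ofReal_mul (by positivity),
    ← ENNReal.ofReal_div_of_pos (by positivity)]
  congr 1
  rw [sub_eq_add_neg, Real.exp_add, Real.exp_neg (l2norm w ^ 2)]
  have := Real.exp_pos (l2norm w ^ 2)
  field_simp
  ring

/-- For one block, the change of measure by `exp (-S)` produces a probability measure on the
output space that does not depend on the input and is invariant under unitary operators. -/
theorem exists_outputMeasure {κ ρ : ℝ} (hκ : 0 ≤ κ) (hρ : 0 < ρ) (n : ℕ) :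
    ∃ (Q : Measure (Fin (n + 1) → ℂ)) (f : (Fin (n + 1) → ℂ) → ℝ≥0∞), Measurable f ∧
      (∀ᵐ w ∂stdNoise (n + 1), f w = ENNReal.ofReal (Real.exp (-S κ ρ 1 w))) ∧
      IsProbabilityMeasure Q ∧
      ((stdNoise (n + 1)).withDensity f).map (wTilde κ ρ) = Q ∧
      ∀ L, Q.map (unitaryMap L) = Q := by
  have hT := (continuous_wTilde κ ρ (n + 1)).measurable
  have hq := measurable_outputPDF κ ρ n
  have hp := (measurable_refPDF κ ρ n).ennreal_ofReal
  have hmass := lintegral_outputPDF hκ hρ n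
  refine ⟨volume.withDensity (outputPDF κ ρ n), fun w => outputPDF κ ρ n (wTilde κ ρ w) /
    ENNReal.ofReal (refPDF κ ρ n (wTilde κ ρ w)), (hq.div hp).comp hT, ?_, ⟨?_⟩, ?_, ?_⟩
  -- `S` has default values where `wTilde` vanishes or the radial integral diverges. The second set
  -- is null because `outputPDF` has finite mass; both exclusions pass to the noise by absolute
  -- continuity of `refLaw`.
  · have hvol : ∀ᵐ y : Fin (n + 1) → ℂ, y ≠ 0 ∧ radialIntegral κ ρ n (l2norm y) ≠ ∞ := by
      have h0 : ∀ᵐ y : Fin (n + 1) → ℂ, y ≠ 0 := by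
        simp [ae_iff]
      filter_upwards [h0, ae_lt_top hq (by rw [hmass]; exact ENNReal.one_ne_top)] with y hy hfin
      refine ⟨hy, fun htop => hfin.ne ?_⟩
      have hs := sigmaHsq_pos hκ
      rw [outputPDF, htop, ENNReal.mul_top (ENNReal.ofReal_pos.2 (Real.exp_pos _)).ne',
        ENNReal.mul_top (ENNReal.ofReal_pos.2 (by positivity)).ne']
    have href : ∀ᵐ y ∂(stdNoise (n + 1)).map (wTilde κ ρ),
        y ≠ 0 ∧ radialIntegral κ ρ n (l2norm y) ≠ ∞ := by
      rw [map_wTilde hκ hρ, refLaw_eq_withDensity hκ hρ]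
      exact (withDensity_absolutelyContinuous _ _).ae_le hvol
    filter_upwards [ae_of_ae_map hT.aemeasurable href] with w hw
    exact ofReal_exp_neg_S hκ hρ n hw.1 hw.2
  · rw [withDensity_apply _ MeasurableSet.univ, setLIntegral_univ, hmass]
  · rw [map_withDensity_comp _ hT (g := fun y => outputPDF κ ρ n y /
      ENNReal.ofReal (refPDF κ ρ n y)) (hq.div hp), map_wTilde hκ hρ,
      refLaw_eq_withDensity hκ hρ]
    refine (withDensity_mul _ hp (hq.div hp)).symm.trans ?_
    congr 1
    funext y
    exact ENNReal.mul_div_cancel (ENNReal.ofReal_pos.2 (refPDF_pos hκ hρ n y)).ne'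
      ENNReal.ofReal_ne_top
  · exact fun L => map_unitaryMap_withDensity L hq fun y => by
      rw [outputPDF, l2norm_unitaryMap, outputPDF]

instance {κ : ℝ} {n : ℕ} (x : Fin n → ℂ) : IsProbabilityMeasure (blockLaw κ x) :=
  Measure.isProbabilityMeasure_map (by fun_prop)

instance {κ : ℝ} {ℓ n : ℕ} (x : Fin ℓ → Fin n → ℂ) : IsProbabilityMeasure (outputLaw κ x) := by
  rw [outputLaw_eq_pi]; infer_instance

/-! ### The converse: change of measure over all blocks and summation over codewords. -/

/-- Change of measure from the channel output to a fixed output distribution `Q`, for all inputs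
satisfying the power constraint. -/
theorem exists_outputLaw_le {κ ρ : ℝ} (hκ : 0 ≤ κ) (hρ : 0 < ρ) (ℓ n : ℕ) (t : ℝ) :
    ∃ Q : Measure (Fin ℓ → Fin (n + 1) → ℂ), IsProbabilityMeasure Q ∧
      ∀ x : Fin ℓ → Fin (n + 1) → ℂ, (∀ k, l2norm (x k) ^ 2 = (n + 1 : ℕ) * ρ) →
        ∀ A, MeasurableSet A → (outputLaw κ x).real A ≤
          1 - (noiseLaw ℓ (n + 1)).real {w | ∑ k, S κ ρ 1 (w k) ≤ t} +
            Real.exp t * Q.real A := by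
  obtain ⟨Q, f, hf, hfS, hQ, hmap, hinv⟩ := exists_outputMeasure hκ hρ n
  have hT := (continuous_wTilde κ ρ (n + 1)).measurable
  have hfin : IsProbabilityMeasure ((stdNoise (n + 1)).withDensity f) := by
    constructor
    have h : Q Set.univ = 1 := measure_univ
    rwa [← hmap, Measure.map_apply hT MeasurableSet.univ, Set.preimage_univ] at h
  refine ⟨Measure.pi fun _ => Q, inferInstance, fun x hx A hA => ?_⟩
  set ν : Measure (Fin ℓ → Fin (n + 1) → ℂ) := Measure.pi fun _ => stdNoise (n + 1) with hν
  have hνeq : noiseLaw ℓ (n + 1) = ν := rfl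
  choose L hL using fun k => exists_blockLaw_eq_map hκ hρ (x k) (hx k)
  set Φ : (Fin ℓ → Fin (n + 1) → ℂ) → Fin ℓ → Fin (n + 1) → ℂ :=
    fun w k => unitaryMap (L k) (wTilde κ ρ (w k)) with hΦ
  have hΦk (k : Fin ℓ) : Measurable fun w : Fin (n + 1) → ℂ => unitaryMap (L k) (wTilde κ ρ w) :=
    (continuous_unitaryMap (L k)).measurable.comp hT
  have hΦm : Measurable Φ :=
    measurable_pi_lambda _ fun k => (hΦk k).comp (measurable_pi_apply k)
  have hout : outputLaw κ x = ν.map Φ := by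
    have hk (k : Fin ℓ) : blockLaw κ (x k) =
        (stdNoise (n + 1)).map fun w => unitaryMap (L k) (wTilde κ ρ w) := by
      rw [hL k, ← map_wTilde hκ hρ, Measure.map_map (continuous_unitaryMap (L k)).measurable hT]
      rfl
    have (k : Fin ℓ) : IsProbabilityMeasure
        ((stdNoise (n + 1)).map fun w => unitaryMap (L k) (wTilde κ ρ w)) := by
      rw [← hk k]; infer_instance
    rw [outputLaw_eq_pi, hΦ, hν, Measure.pi_map_pi fun k => (hΦk k).aemeasurable]
    exact congrArg _ (funext hk)
  set F : (Fin ℓ → Fin (n + 1) → ℂ) → ℝ≥0∞ := fun w => ∏ k, f (w k) with hF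
  have hFm : Measurable F :=
    Finset.measurable_fun_prod _ fun k _ => hf.comp (measurable_pi_apply k)
  -- The rotations inside `Φ` depend on the input, but Q is invariant under them; hence the same
  -- output law serves every codeword.
  have hQmap : (ν.withDensity F).map Φ = Measure.pi fun _ => Q := by
    have hk (k : Fin ℓ) : ((stdNoise (n + 1)).withDensity f).map
        (fun w => unitaryMap (L k) (wTilde κ ρ w)) = Q := by
      conv_rhs => rw [← hinv (L k), ← hmap,
        Measure.map_map (continuous_unitaryMap (L k)).measurable hT]
      rfl
    have (k : Fin ℓ) : IsProbabilityMeasure (((stdNoise (n + 1)).withDensity f).map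
        fun w => unitaryMap (L k) (wTilde κ ρ w)) := by
      rw [hk k]; infer_instance
    rw [hν, hF, ← pi_withDensity (fun _ => stdNoise (n + 1)) fun _ => hf,
      Measure.pi_map_pi fun k => (hΦk k).aemeasurable]
    exact congrArg _ (funext hk)
  -- A measurable version of the event ∑ S_k ≤ t, written with the measurable density `f`; no
  -- measurability of `S` is needed.
  set G : Set (Fin ℓ → Fin (n + 1) → ℂ) := {w | ENNReal.ofReal (Real.exp (-t)) ≤ F w} with hG
  have hGm : MeasurableSet G := measurableSet_le measurable_const hFm
  have hGS : ν {w | ∑ k, S κ ρ 1 (w k) ≤ t} = ν G := by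
    have hae : ∀ᵐ w ∂ν, ∀ k, f (w k) = ENNReal.ofReal (Real.exp (-S κ ρ 1 (w k))) :=
      ae_all_iff.2 fun k =>
        (Measure.tendsto_eval_ae_ae (μ := fun _ : Fin ℓ => stdNoise (n + 1)) (i := k)).eventually hfS
    refine measure_congr ?_
    filter_upwards [hae] with w hw
    refine propext ?_
    change ∑ k, S κ ρ 1 (w k) ≤ t ↔ ENNReal.ofReal (Real.exp (-t)) ≤ ∏ k, f (w k)
    simp_rw [hw]
    rw [← ENNReal.ofReal_prod_of_nonneg fun _ _ => (Real.exp_pos _).le, ← Real.exp_sum,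
      ENNReal.ofReal_le_ofReal_iff (Real.exp_pos _).le, Real.exp_le_exp, Finset.sum_neg_distrib,
      neg_le_neg_iff]
  have hGle : ν (Φ ⁻¹' A ∩ G) ≤ ENNReal.ofReal (Real.exp t) * (Measure.pi fun _ => Q) A := by
    rw [← hQmap, Measure.map_apply hΦm hA, withDensity_apply _ (hΦm hA),
      ← lintegral_const_mul _ hFm, ← setLIntegral_one]
    refine (setLIntegral_mono (hFm.const_mul (ENNReal.ofReal (Real.exp t)))
      fun w hw => ?_).trans (lintegral_mono_set Set.inter_subset_left)
    calc (1 : ℝ≥0∞) = ENNReal.ofReal (Real.exp t) * ENNReal.ofReal (Real.exp (-t)) := by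
          rw [← ENNReal.ofReal_mul (Real.exp_pos _).le, ← Real.exp_add, add_neg_cancel,
            Real.exp_zero, ENNReal.ofReal_one]
      _ ≤ _ := by gcongr; exact hw.2
  have hreal : ν.real (Φ ⁻¹' A ∩ G) ≤ Real.exp t * (Measure.pi fun _ : Fin ℓ => Q).real A := by
    have h := ENNReal.toReal_mono
      (ENNReal.mul_ne_top ENNReal.ofReal_ne_top (measure_ne_top _ _)) hGle
    rwa [ENNReal.toReal_mul, ENNReal.toReal_ofReal (Real.exp_pos _).le] at h
  have hcompl : ν.real Gᶜ = 1 - ν.real G := probReal_compl_eq_one_sub hGm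
  calc (outputLaw κ x).real A = ν.real (Φ ⁻¹' A) := by
        rw [hout, map_measureReal_apply hΦm hA]
    _ ≤ ν.real (Gᶜ ∪ (Φ ⁻¹' A ∩ G)) := measureReal_mono fun w hw => by
        by_cases h : w ∈ G
        · exact Or.inr ⟨hw, h⟩
        · exact Or.inl h
    _ ≤ ν.real Gᶜ + ν.real (Φ ⁻¹' A ∩ G) := measureReal_union_le _ _
    _ ≤ _ := by
        have h : ν.real {w | ∑ k, S κ ρ 1 (w k) ≤ t} = ν.real G := congrArg ENNReal.toReal hGS
        rw [hcompl, hνeq, h]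
        linarith

/-- The converse bound for a code with `M` codewords. -/
theorem Code.card_mul_le {κ ρ ε : ℝ} (hκ : 0 ≤ κ) (hρ : 0 < ρ) {ℓ n M : ℕ} (hM : 0 < M)
    (C : Code κ ℓ (n + 1) M ε ρ) (t : ℝ) :
    M * ((noiseLaw ℓ (n + 1)).real {w | ∑ k, S κ ρ 1 (w k) ≤ t} - ε) ≤ Real.exp t := by
  obtain ⟨Q, hQ, hle⟩ := exists_outputLaw_le hκ hρ ℓ n t
  set α := (noiseLaw ℓ (n + 1)).real {w | ∑ k, S κ ρ 1 (w k) ≤ t}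
  have hD (j : Fin M) : MeasurableSet {y | C.decoder y = j} :=
    C.measurable_decoder (measurableSet_singleton j)
  have hj (j : Fin M) : 1 - (outputLaw κ (C.encoder j)).real {y | C.decoder y ≠ j} ≤
      1 - α + Real.exp t * Q.real {y | C.decoder y = j} := by
    have h := hle (C.encoder j) (C.power j) _ (hD j)
    have hc : (outputLaw κ (C.encoder j)).real {y | C.decoder y ≠ j} =
        1 - (outputLaw κ (C.encoder j)).real {y | C.decoder y = j} :=
      probReal_compl_eq_one_sub (hD j)
    linarith
  -- The decoding regions partition the output space, so the e^t term is paid once in total and not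
  -- once per codeword.
  have hsum : ∑ j, Q.real {y | C.decoder y = j} = 1 := by
    have h := sum_measureReal_preimage_singleton (μ := Q) (f := C.decoder) Finset.univ
      (fun j _ => hD j)
    rw [Finset.coe_univ, Set.preimage_univ, probReal_univ] at h
    exact h
  have hS := Finset.sum_le_sum fun j (_ : j ∈ Finset.univ) => hj j
  rw [Finset.sum_sub_distrib, Finset.sum_add_distrib, ← Finset.mul_sum, hsum] at hS
  simp only [Finset.sum_const, Finset.card_univ, Fintype.card_fin, nsmul_eq_mul] at hS
  have hM' : (0 : ℝ) < M := by exact_mod_cast hM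
  have he := C.error
  rw [one_div, inv_mul_le_iff₀ hM'] at he
  linarith

end RicianBlockFading

end

theorem mainTheorem6 (κ ρ ε : ℝ) (hκ : 0 ≤ κ) (hρ : 0 < ρ) (ℓ nc : ℕ) (hℓ : 1 ≤ ℓ) (hnc : 1 ≤ nc) :
    RicianBlockFading.maxRate κ ℓ nc ε ρ ≤
      ⨅ (t : ℝ) (_ : 0 ≤ t),
        ((1 / ((ℓ : ℝ) * (nc : ℝ) * Real.log 2) : ℝ) : EReal) *
          ((t : EReal) - ENNReal.log (ENNReal.ofReal (max 0
            ((RicianBlockFading.noiseLaw ℓ nc).real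
              {w | ∑ k : Fin ℓ, RicianBlockFading.S κ ρ 1 (w k) ≤ t} - ε)))) := by
  obtain ⟨n, rfl⟩ : ∃ n, nc = n + 1 := ⟨nc - 1, by omega⟩
  refine sSup_le ?_
  rintro _ ⟨M, hM, ⟨C⟩, rfl⟩
  refine le_iInf₂ fun t _ => ?_
  have hle := C.card_mul_le hκ hρ hM t
  set d := (RicianBlockFading.noiseLaw ℓ (n + 1)).real
    {w | ∑ k : Fin ℓ, RicianBlockFading.S κ ρ 1 (w k) ≤ t} - ε
  have hℓ' : (0 : ℝ) < ℓ := by exact_mod_cast hℓ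
  have hn' : (0 : ℝ) < (n + 1 : ℕ) := by positivity
  have hlog : 0 < Real.log 2 := Real.log_pos one_lt_two
  have hpos : 0 < 1 / ((ℓ : ℝ) * ((n + 1 : ℕ) : ℝ) * Real.log 2) := by positivity
  have hM' : (0 : ℝ) < M := by exact_mod_cast hM
  rcases le_or_gt d 0 with hd | hd
  -- The bracket vanishes, log 0 is ⊥, and the bound is ⊤.
  · rw [max_eq_left hd, ENNReal.ofReal_zero, ENNReal.log_zero, EReal.coe_sub_bot,
      EReal.coe_mul_top_of_pos hpos]
    exact le_top
  · rw [max_eq_right hd.le, ENNReal.log_ofReal_of_pos hd, ← EReal.coe_sub, ← EReal.coe_mul,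
      EReal.coe_le_coe_iff]
    have hlogM : Real.log M + Real.log d ≤ t := by
      rw [← Real.log_mul hM'.ne' hd.ne']
      exact (Real.log_le_iff_le_exp (by positivity)).2 hle
    rw [Real.logb, div_div, div_mul_eq_mul_div, one_mul, mul_comm (Real.log 2)]
    gcongr
    linarith
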